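/- Let $l,m\ge 0$ and $n_1,\dots,n_l\ge 0$ be integers. For $i=1,\dots,l$ let $X_i\subseteq\mathbb{R}^{n_i}$, put $X=X_1\times\dots\times X_l$, and let $f_i:X\to\mathbb{R}$ and $h_i=(h_{i1},\dots,h_{im}):\mathbb{R}^{n_i}\to\mathbb{R}^m$; let $b\in\mathbb{R}^m$. Vectors of $\mathbb{R}^m$ are compared coordinatewise, $\|\cdot\|$ is the Euclidean norm, and $(x_{-i},y_i)$ denotes $x$ with its $i$-th block replaced by $y_i$. For $x,y\in X$ let $$\Psi(x,y)=\sum_{i=1}^{l} f_i(x_{-i},y_i),\qquad \Phi(x,y)=\Psi(x,x)-\Psi(x,y).$$ Assume: (A1) each $X_i$ is convex and closed; each $f_i$ is continuous on $X$ and concave in its $i$-th variable $x_i\in X_i$ (the other variables being fixed in their strategy sets); each $h_{ij}:\mathbb{R}^{n_i}\to\mathbb{R}$ is convex; and the set $D=\{x\in X : \sum_{i=1}^{l} h_i(x_i)\le b\}$ is nonempty. (C3) there is a point $\tilde x\in X$ such that $\Phi(x^k,\tilde x)\to-\infty$ for every sequence $\{x^k\}\subset X$ with $\|x^k-\tilde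 x\|\to\infty$. Let $\varphi:\mathbb{R}^m\to\mathbb{R}_+$ be convex, differentiable and isotone ($v\ge v'$ implies $\varphi(v)\ge\varphi(v')$), with $\varphi(v)=0$ if $v\le 0$ and $\varphi(v)>0$ otherwise. Then for every $\tau>0$ and every $u=(u_1,\dots,u_l)$ with $u_i\in\mathbb{R}^m$, the penalized Nash equilibrium problem has a solution: there is $x\in X$ such that $$\tilde f_i(x_{-i},y_i)\le\tilde f_i(x)\qquad\text{for all } y_i\in X_i,\ i=1,\dots,l,$$ where $\tilde f_i(x)=f_i(x)-\tau\,\varphi\bigl(h_i(x_i)-u_i\bigr)$. -/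

import Mathlib

open Filter

/-- Strategy profiles `x = (x₁, …, x_l)` with `xᵢ ∈ ℝ^{nᵢ}`. -/
abbrev Profile {l : ℕ} (n : Fin l → ℕ) : Type :=
  (i : Fin l) → EuclideanSpace ℝ (Fin (n i))

/-- The data of an `l`-person game with joint constraints: strategy sets `Xᵢ ⊆ ℝ^{nᵢ}`, utilities
`fᵢ` (only their values on `X₁ × ⋯ × X_l` are ever used), constraint maps `hᵢ : ℝ^{nᵢ} → ℝ^m`
and the right-hand side `b ∈ ℝ^m`. -/
structure JointGame (l m : ℕ) (n : Fin l → ℕ) where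
  strat : (i : Fin l) → Set (EuclideanSpace ℝ (Fin (n i)))
  utility : Fin l → Profile n → ℝ
  constr : (i : Fin l) → EuclideanSpace ℝ (Fin (n i)) → Fin m → ℝ
  bound : Fin m → ℝ

namespace JointGame

variable {l m : ℕ} {n : Fin l → ℕ}

/-- `X = X₁ × ⋯ × X_l`. -/
def profiles (G : JointGame l m n) : Set (Profile n) :=
  {x | ∀ i, x i ∈ G.strat i}

/-- The common feasible set `D = {x ∈ X | ∑ᵢ hᵢ(xᵢ) ≤ b}`, with the coordinatewise order. -/
def feasible (G : JointGame l m n) : Set (Profile n) :=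
  {x | x ∈ G.profiles ∧ ∑ i, G.constr i (x i) ≤ G.bound}

/-- The basic assumptions on the game. -/
structure BasicAssumptions (G : JointGame l m n) : Prop where
  convex_strat : ∀ i, Convex ℝ (G.strat i)
  closed_strat : ∀ i, IsClosed (G.strat i)
  concave_utility : ∀ i, ∀ x ∈ G.profiles,
    ConcaveOn ℝ (G.strat i) (fun y => G.utility i (Function.update x i y))
  continuous_utility : ∀ i, ContinuousOn (G.utility i) G.profiles
  convex_constr : ∀ i j, ConvexOn ℝ Set.univ (fun y => G.constr i y j)
  feasible_nonempty : G.feasible.Nonempty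

/-- `Ψ(x, y) = ∑ᵢ fᵢ(x₋ᵢ, yᵢ)`. -/
noncomputable def psi (G : JointGame l m n) (x y : Profile n) : ℝ :=
  ∑ i, G.utility i (Function.update x i (y i))

/-- The normalized (Nikaido–Isoda) bifunction `Φ(x, y) = Ψ(x, x) - Ψ(x, y)`. -/
noncomputable def phi (G : JointGame l m n) (x y : Profile n) : ℝ :=
  G.psi x x - G.psi x y

/-- Coercivity: some `x̃ ∈ X` satisfies `Φ(xᵏ, x̃) → -∞` for every sequence `xᵏ` in `X` with
`‖xᵏ - x̃‖ → ∞`, where `‖·‖` is the Euclidean norm of `ℝ^{n₁ + ⋯ + n_l}`. -/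
def Coercive (G : JointGame l m n) : Prop :=
  ∃ xt ∈ G.profiles, ∀ x : ℕ → Profile n, (∀ k, x k ∈ G.profiles) →
    Tendsto (fun k => ‖WithLp.toLp 2 (x k - xt)‖) atTop atTop →
    Tendsto (fun k => G.phi (x k) xt) atTop atBot

/-- The penalized utilities `f̃ᵢ(x) = fᵢ(x) - τ Pᵢ(xᵢ, uᵢ)`, `Pᵢ(xᵢ, uᵢ) = φ(hᵢ(xᵢ) - uᵢ)`. -/
noncomputable def penalizedUtility (G : JointGame l m n) (φ : (Fin m → ℝ) → ℝ) (τ : ℝ)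
    (u : Fin l → Fin m → ℝ) (i : Fin l) (x : Profile n) : ℝ :=
  G.utility i x - τ * φ (G.constr i (x i) - u i)

end JointGame

/-- `φ : ℝ^m → ℝ₊` is convex, differentiable and isotone, vanishes on `{v | v ≤ 0}` and is positive
elsewhere. -/
structure IsPenalty {m : ℕ} (φ : (Fin m → ℝ) → ℝ) : Prop where
  convex : ConvexOn ℝ Set.univ φ
  differentiable : Differentiable ℝ φ
  isotone : Monotone φ
  eq_zero : ∀ v, v ≤ 0 → φ v = 0
  pos : ∀ v, ¬ v ≤ 0 → 0 < φ v

/-- `x` solves the Nash equilibrium problem with strategy sets `Xᵢ` and utilities `gᵢ`: `x ∈ X` and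
`gᵢ(x₋ᵢ, yᵢ) ≤ gᵢ(x)` for all `i` and all `yᵢ ∈ Xᵢ`. -/
def IsNashEquilibrium {l : ℕ} {n : Fin l → ℕ}
    (X : (i : Fin l) → Set (EuclideanSpace ℝ (Fin (n i)))) (g : Fin l → Profile n → ℝ)
    (x : Profile n) : Prop :=
  (∀ i, x i ∈ X i) ∧ ∀ i, ∀ y ∈ X i, g i (Function.update x i y) ≤ g i x

/-! Penalization keeps the game continuous and concave, because an isotone convex function of convex
constraints is convex. Coercivity also survives: the penalty at `x` is nonnegative and the one at
`xt` is a constant, so far from `xt` joint deviation to `xt` raises total utility. Existence then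
follows from the Ky Fan inequality for the Nikaido–Isoda function on strategies truncated to a ball
(`exists_forall_le_zero`). The solution lies strictly inside the ball, and concavity turns this
local optimality into a global one (`exists_isNashEquilibrium`).

Ky Fan reduces by compactness to finitely many deviations, hence to a covering theorem on the
simplex (`exists_common_point_of_face_subset`). That theorem is the limit of Scarf's combinatorial
lemma (`exists_dominant_colourful`) applied to finite nets; the lemma itself is a parity count. -/

/-! ### Dominant sets and Scarf's lemma -/

section Scarf

variable {V I α : Type*} [LinearOrder α]

/-- `S` is dominant for the family of orders induced by the keys `r i` if every `t` lies below all of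
`S` in one of these orders. -/
def Dominant (r : I → V → α) (S : Finset V) : Prop :=
  ∀ t, ∃ i, ∀ s ∈ S, r i t ≤ r i s

theorem Dominant.mono {r : I → V → α} {S R : Finset V} (h : Dominant r R) (hSR : S ⊆ R) :
    Dominant r S := fun t =>
  let ⟨i, hi⟩ := h t
  ⟨i, fun s hs => hi s (hSR hs)⟩

/-- `m i` is the smallest element of `S` in the `i`-th order. -/
def IsMinChoice (r : I → V → α) (S : Finset V) (m : I → V) : Prop :=
  ∀ i, m i ∈ S ∧ ∀ s ∈ S, r i (m i) ≤ r i s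

theorem exists_isMinChoice (r : I → V → α) {S : Finset V} (hS : S.Nonempty) :
    ∃ m, IsMinChoice r S m := by
  choose m hm using fun i => S.exists_min_image (r i) hS
  exact ⟨m, hm⟩

/-- Dominance is tested at `y` itself. Thus `m` maps the orders onto `S`, and if `S` has one element
fewer than there are orders, exactly two minima coincide. -/
theorem IsMinChoice.exists_eq {r : I → V → α} (hr : ∀ i, Function.Injective (r i))
    {S : Finset V} {m : I → V} (hm : IsMinChoice r S m) (hS : Dominant r S) {y : V} (hy : y ∈ S) :
    ∃ i, m i = y := by
  obtain ⟨i, hi⟩ := hS y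
  exact ⟨i, hr i (le_antisymm ((hm i).2 y hy) (hi _ (hm i).1))⟩

theorem IsMinChoice.injOn [Fintype I] [DecidableEq I] {r : I → V → α}
    {S : Finset V} {m : I → V} (hm : IsMinChoice r S m) (hcard : S.card + 1 = Fintype.card I)
    {j : I} (hj : ∀ y ∈ S, ∃ k, k ≠ j ∧ m k = y) {k k' : I} (hk : k ≠ j) (hk' : k' ≠ j)
    (h : m k = m k') : k = k' := by
  have hinj : Set.InjOn m ((Finset.univ.erase j : Finset I) : Set I) := by
    refine Finset.injOn_of_surjOn_of_card_le m (t := S) (fun i _ => (hm i).1) ?_ ?_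
    · intro y hy
      obtain ⟨k, hk, rfl⟩ := hj y hy
      exact ⟨k, by simpa using hk, rfl⟩
    · rw [Finset.card_erase_of_mem (Finset.mem_univ j), Finset.card_univ]
      omega
  exact hinj (by simpa using hk) (by simpa using hk') h

theorem IsMinChoice.exists_pair [Fintype I] [DecidableEq I] {r : I → V → α}
    {S : Finset V} {m : I → V} (hm : IsMinChoice r S m) (hcard : S.card + 1 = Fintype.card I) :
    ∃ a b, a ≠ b ∧ m a = m b := by
  obtain ⟨a, -, b, -, hab, h⟩ := Finset.exists_ne_map_eq_of_card_lt_of_maps_to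
    (s := (Finset.univ : Finset I)) (t := S) (f := m)
    (by rw [Finset.card_univ]; omega) (fun i _ => (hm i).1)
  exact ⟨a, b, hab, h⟩

/-- An element that extends `S` by replacing the minimum in the `j`-th order. -/
def Replaces (r : I → V → α) (m : I → V) (j : I) (x : V) : Prop :=
  ∀ k, k ≠ j → r k (m k) < r k x

/-- Dominance tested at the rival `x'` can only be witnessed by order `j`, since `x'` exceeds the
minimum of `S` in every other order. By symmetry both keys in order `j` agree. -/
theorem Replaces.unique [DecidableEq V] {r : I → V → α} (hr : ∀ i, Function.Injective (r i))
    {S : Finset V} {m : I → V} (hm : IsMinChoice r S m) {j : I} {x x' : V}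
    (hx : Replaces r m j x) (hx' : Replaces r m j x')
    (hd : Dominant r (insert x S)) (hd' : Dominant r (insert x' S)) : x = x' := by
  have key : ∀ {x x' : V}, Replaces r m j x' → Dominant r (insert x S) → r j x' ≤ r j x := by
    intro x x' hx' hd
    obtain ⟨i, hi⟩ := hd x'
    by_cases hij : i = j
    · subst hij
      exact hi x (Finset.mem_insert_self _ _)
    · exact absurd (hi (m i) (Finset.mem_insert_of_mem (hm i).1)) (not_le.2 (hx' i hij))
  exact hr j (le_antisymm (key hx hd') (key hx' hd))

/-- Among all candidates, the largest in order `a` works: other candidates are dominated in order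
`a`, non-candidates in the order where they fail. The coincidence `m a = m b` keeps the choice
outside `S`. -/
theorem Replaces.exists_dominant [Fintype V] [DecidableEq V] {r : I → V → α}
    (hr : ∀ i, Function.Injective (r i)) {S : Finset V} {m : I → V} (hm : IsMinChoice r S m)
    (hS : Dominant r S) {a b : I} (hab : a ≠ b) (h : m a = m b)
    (hne : ∃ x, Replaces r m a x) :
    ∃ x, x ∉ S ∧ Dominant r (insert x S) ∧ Replaces r m a x := by
  classical
  obtain ⟨x, hx, hmax⟩ := (Finset.univ.filter (Replaces r m a)).exists_max_image (r a)
    (by obtain ⟨x, hx⟩ := hne; exact ⟨x, by simpa using hx⟩)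
  simp only [Finset.mem_filter, Finset.mem_univ, true_and] at hx hmax
  refine ⟨x, fun hxS => ?_, fun t => ?_, hx⟩
  · obtain ⟨i, rfl⟩ := hm.exists_eq hr hS hxS
    by_cases hi : i = a
    · subst hi
      have := hx b hab.symm
      rw [h] at this
      exact lt_irrefl _ this
    · exact lt_irrefl _ (hx i hi)
  · by_cases ht : Replaces r m a t
    · refine ⟨a, fun s hs => ?_⟩
      rcases Finset.mem_insert.1 hs with rfl | hs
      · exact hmax t ht
      · obtain ⟨i, hi⟩ := hS t
        by_cases hia : i = a
        · subst hia
          exact hi s hs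
        · exact absurd (hi _ (hm i).1) (not_le.2 (ht i hia))
    · simp only [Replaces, not_forall, not_lt] at ht
      obtain ⟨k, hk, hle⟩ := ht
      refine ⟨k, fun s hs => ?_⟩
      rcases Finset.mem_insert.1 hs with rfl | hs
      · exact hle.trans (hx k hk).le
      · exact hle.trans ((hm k).2 s hs)

/-- Let `j` be an order that puts `x` below all of `S`. The minima in the remaining orders must
exhaust `S`, so by cardinality they are distinct; hence `j` is one of the coinciding indices `a`,
`b`. -/
theorem Dominant.replaces_or [Fintype I] [DecidableEq I] [DecidableEq V] {r : I → V → α}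
    (hr : ∀ i, Function.Injective (r i)) {S : Finset V} {m : I → V} (hm : IsMinChoice r S m)
    (hcard : S.card + 1 = Fintype.card I) {a b : I} (hab : a ≠ b) (h : m a = m b)
    {x : V} (hx : x ∉ S) (hd : Dominant r (insert x S)) :
    Replaces r m a x ∨ Replaces r m b x := by
  obtain ⟨j, hj⟩ := hd x
  have hk : ∀ y ∈ S, ∃ k, k ≠ j ∧ m k = y ∧ r k (m k) < r k x := by
    intro y hy
    obtain ⟨k, hk⟩ := hd y
    have hmk : m k = y :=
      hr k (le_antisymm ((hm k).2 y hy) (hk _ (Finset.mem_insert_of_mem (hm k).1)))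
    have hlt : r k y < r k x := lt_of_le_of_ne (hk x (Finset.mem_insert_self _ _))
      fun he => hx (hr k he ▸ hy)
    refine ⟨k, ?_, hmk, by rwa [hmk]⟩
    rintro rfl
    exact absurd (hj y (Finset.mem_insert_of_mem hy)) (not_le.2 hlt)
  have hinj : ∀ {k k' : I}, k ≠ j → k' ≠ j → m k = m k' → k = k' := fun hk1 hk2 he =>
    hm.injOn hcard (fun y hy => let ⟨k, h1, h2, _⟩ := hk y hy; ⟨k, h1, h2⟩) hk1 hk2 he
  have hrep : Replaces r m j x := by
    intro k hkj
    obtain ⟨k', hk', he, hlt⟩ := hk (m k) (hm k).1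
    rwa [hinj hk' hkj he] at hlt
  by_cases hja : j = a
  · exact Or.inl (hja ▸ hrep)
  by_cases hjb : j = b
  · exact Or.inr (hjb ▸ hrep)
  exact absurd (hinj (Ne.symm hja) (Ne.symm hjb) h) hab

theorem Dominant.not_replaces_both {r : I → V → α} {S : Finset V} {m : I → V}
    (hm : IsMinChoice r S m) (hS : Dominant r S) {a b : I} (hab : a ≠ b) {x : V}
    (ha : Replaces r m a x) (hb : Replaces r m b x) : False := by
  obtain ⟨i, hi⟩ := hS x
  have := hi _ (hm i).1
  by_cases hia : i = a
  · exact absurd this (not_le.2 (hb i (hia ▸ hab)))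
  · exact absurd this (not_le.2 (ha i hia))

/-! ### Counting incidences between rooms and doors -/

section Count

variable [Fintype V] [Fintype I]

open Classical in
/-- The dominant sets of full cardinality. -/
noncomputable def rooms (r : I → V → α) : Finset (Finset V) :=
  Finset.univ.filter fun R => Dominant r R ∧ R.card = Fintype.card I

theorem mem_rooms {r : I → V → α} {R : Finset V} :
    R ∈ rooms r ↔ Dominant r R ∧ R.card = Fintype.card I := by simp [rooms]

theorem mem_rooms_superset_iff [DecidableEq V] {r : I → V → α} {S R : Finset V}
    (hcard : S.card + 1 = Fintype.card I) :
    R ∈ (rooms r).filter (S ⊆ ·) ↔ ∃ x, x ∉ S ∧ Dominant r (insert x S) ∧ R = insert x S := by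
  rw [Finset.mem_filter, mem_rooms]
  constructor
  · rintro ⟨⟨hd, hc⟩, hS⟩
    have h1 : (R \ S).card = 1 := by
      rw [Finset.card_sdiff_of_subset hS]; omega
    obtain ⟨x, hx⟩ := Finset.card_eq_one.1 h1
    have hxm : x ∈ R \ S := hx ▸ Finset.mem_singleton_self x
    have hR : R = insert x S := by
      rw [← Finset.sdiff_union_of_subset hS, hx]; rfl
    exact ⟨x, (Finset.mem_sdiff.1 hxm).2, hR ▸ hd, hR⟩
  · rintro ⟨x, hx, hd, rfl⟩
    exact ⟨⟨hd, by rw [Finset.card_insert_of_notMem hx, hcard]⟩, Finset.subset_insert _ _⟩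

variable [DecidableEq I]

open Classical in
/-- The dominant sets of cardinality one less than full that carry all colours but `i₀`. -/
noncomputable def doors (r : I → V → α) (c : V → I) (i₀ : I) : Finset (Finset V) :=
  Finset.univ.filter fun S => Dominant r S ∧ S.card + 1 = Fintype.card I ∧
    S.image c = Finset.univ.erase i₀

theorem mem_doors {r : I → V → α} {c : V → I} {i₀ : I} {S : Finset V} :
    S ∈ doors r c i₀ ↔ Dominant r S ∧ S.card + 1 = Fintype.card I ∧
      S.image c = Finset.univ.erase i₀ := by simp [doors]

variable [DecidableEq V]

/-- A set with a replacement for both coinciding minima lies in exactly two rooms. -/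
theorem card_rooms_superset_eq_two {r : I → V → α} (hr : ∀ i, Function.Injective (r i))
    {S : Finset V} {m : I → V} (hm : IsMinChoice r S m) (hS : Dominant r S)
    (hcard : S.card + 1 = Fintype.card I) {a b : I} (hab : a ≠ b) (h : m a = m b)
    (ha : ∃ x, Replaces r m a x) (hb : ∃ x, Replaces r m b x) :
    ((rooms r).filter (S ⊆ ·)).card = 2 := by
  obtain ⟨x, hxS, hxd, hx⟩ := Replaces.exists_dominant hr hm hS hab h ha
  obtain ⟨y, hyS, hyd, hy⟩ := Replaces.exists_dominant hr hm hS hab.symm h.symm hb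
  rw [Finset.card_eq_two]
  refine ⟨insert x S, insert y S, fun he => ?_, ?_⟩
  · have hxy : x = y := by
      have := he ▸ Finset.mem_insert_self x S
      exact (Finset.mem_insert.1 this).resolve_right hxS
    exact hS.not_replaces_both hm hab hx (hxy ▸ hy)
  · ext R
    rw [mem_rooms_superset_iff hcard, Finset.mem_insert, Finset.mem_singleton]
    constructor
    · rintro ⟨z, hzS, hzd, rfl⟩
      rcases hzd.replaces_or hr hm hcard hab h hzS with hz | hz
      · exact Or.inl (by rw [hz.unique hr hm hx hzd hxd])
      · exact Or.inr (by rw [hz.unique hr hm hy hzd hyd])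
    · rintro (rfl | rfl)
      · exact ⟨x, hxS, hxd, rfl⟩
      · exact ⟨y, hyS, hyd, rfl⟩

/-- A set with a replacement for only one of the coinciding minima lies in exactly one room. -/
theorem card_rooms_superset_eq_one {r : I → V → α} (hr : ∀ i, Function.Injective (r i))
    {S : Finset V} {m : I → V} (hm : IsMinChoice r S m) (hS : Dominant r S)
    (hcard : S.card + 1 = Fintype.card I) {a b : I} (hab : a ≠ b) (h : m a = m b)
    (ha : ∃ x, Replaces r m a x) (hb : ¬ ∃ x, Replaces r m b x) :
    ((rooms r).filter (S ⊆ ·)).card = 1 := by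
  obtain ⟨x, hxS, hxd, hx⟩ := Replaces.exists_dominant hr hm hS hab h ha
  rw [Finset.card_eq_one]
  refine ⟨insert x S, ?_⟩
  ext R
  rw [mem_rooms_superset_iff hcard, Finset.mem_singleton]
  constructor
  · rintro ⟨z, hzS, hzd, rfl⟩
    rcases hzd.replaces_or hr hm hcard hab h hzS with hz | hz
    · rw [hz.unique hr hm hx hzd hxd]
    · exact absurd ⟨z, hz⟩ hb
  · rintro rfl
    exact ⟨x, hxS, hxd, rfl⟩

/-- A room that misses a colour contains an even number of doors. -/
theorem even_card_doors_subset {r : I → V → α} {c : V → I} {i₀ : I} {R : Finset V}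
    (hR : R ∈ rooms r) (hc : R.image c ≠ Finset.univ) :
    Even ((doors r c i₀).filter (· ⊆ R)).card := by
  obtain ⟨hd, hcard⟩ := mem_rooms.1 hR
  have herase : ∀ S, S ∈ (doors r c i₀).filter (· ⊆ R) ↔
      ∃ x ∈ R, S = R.erase x ∧ (R.erase x).image c = Finset.univ.erase i₀ := by
    intro S
    rw [Finset.mem_filter, mem_doors]
    constructor
    · rintro ⟨⟨-, hSc, hSi⟩, hSR⟩
      have h1 : (R \ S).card = 1 := by
        rw [Finset.card_sdiff_of_subset hSR]; omega
      obtain ⟨x, hx⟩ := Finset.card_eq_one.1 h1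
      have hxm : x ∈ R \ S := hx ▸ Finset.mem_singleton_self x
      have hS : S = R.erase x := by
        rw [← Finset.sdiff_singleton_eq_erase, ← hx, Finset.sdiff_sdiff_eq_self hSR]
      exact ⟨x, (Finset.mem_sdiff.1 hxm).1, hS, hS ▸ hSi⟩
    · rintro ⟨x, hx, rfl, hi⟩
      refine ⟨⟨hd.mono (Finset.erase_subset _ _), ?_, hi⟩, Finset.erase_subset _ _⟩
      rw [Finset.card_erase_add_one hx, hcard]
  rcases Finset.eq_empty_or_nonempty ((doors r c i₀).filter (· ⊆ R)) with he | ⟨S, hS⟩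
  · simp [he]
  obtain ⟨x, hx, -, hi⟩ := (herase S).1 hS
  have hinj : Set.InjOn c (R.erase x : Finset V) := by
    rw [← Finset.card_image_iff, hi, Finset.card_erase_of_mem hx,
      Finset.card_erase_of_mem (Finset.mem_univ _), hcard, Finset.card_univ]
  have hsub : ∀ z ∈ R, z ≠ x → c z ≠ i₀ := by
    intro z hz hzx
    have : c z ∈ (R.erase x).image c :=
      Finset.mem_image_of_mem c (Finset.mem_erase.2 ⟨hzx, hz⟩)
    rw [hi] at this
    exact (Finset.mem_erase.1 this).1
  have hRi : R.image c = insert (c x) (Finset.univ.erase i₀) := by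
    rw [← hi, ← Finset.image_insert, Finset.insert_erase hx]
  have hcx : c x ≠ i₀ := by
    intro he
    exact hc (by rw [hRi, he, Finset.insert_erase (Finset.mem_univ _)])
  have hmem : c x ∈ (R.erase x).image c := by
    rw [hi]; exact Finset.mem_erase.2 ⟨hcx, Finset.mem_univ _⟩
  -- `y` is the only other element with the colour of `x`; deleting either one gives a door, and no
  -- other deletion does.
  obtain ⟨y, hy, hyx⟩ := Finset.mem_image.1 hmem
  obtain ⟨hyne, hyR⟩ := Finset.mem_erase.1 hy
  have hiy : (R.erase y).image c = Finset.univ.erase i₀ := by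
    rw [← hi]
    ext k
    simp only [Finset.mem_image, Finset.mem_erase]
    constructor
    · rintro ⟨z, ⟨hz, hzR⟩, rfl⟩
      by_cases hzx : z = x
      · exact ⟨y, ⟨hyne, hyR⟩, hzx ▸ hyx⟩
      · exact ⟨z, ⟨hzx, hzR⟩, rfl⟩
    · rintro ⟨z, ⟨hz, hzR⟩, rfl⟩
      by_cases hzy : z = y
      · exact ⟨x, ⟨hyne.symm, hx⟩, hzy ▸ hyx.symm⟩
      · exact ⟨z, ⟨hzy, hzR⟩, rfl⟩
  have hpair : (doors r c i₀).filter (· ⊆ R) = {R.erase x, R.erase y} := by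
    ext S'
    rw [herase, Finset.mem_insert, Finset.mem_singleton]
    constructor
    · rintro ⟨z, hz, rfl, hiz⟩
      by_contra hne
      have hzx : z ≠ x := fun h => hne (Or.inl (h ▸ rfl))
      have hzy : z ≠ y := fun h => hne (Or.inr (h ▸ rfl))
      have : c z ∈ (R.erase z).image c := by
        rw [hiz]; exact Finset.mem_erase.2 ⟨hsub z hz hzx, Finset.mem_univ _⟩
      obtain ⟨w, hw, hwz⟩ := Finset.mem_image.1 this
      obtain ⟨hwne, hwR⟩ := Finset.mem_erase.1 hw
      have hzm : z ∈ R.erase x := Finset.mem_erase.2 ⟨hzx, hz⟩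
      by_cases hwx : w = x
      · subst hwx
        exact hzy (hinj hzm hy (hwz.symm.trans hyx.symm))
      · exact hwne (hinj (Finset.mem_erase.2 ⟨hwx, hwR⟩) hzm hwz)
    · rintro (rfl | rfl)
      · exact ⟨x, hx, rfl, hi⟩
      · exact ⟨y, hyR, rfl, hiy⟩
  have hneq : R.erase x ≠ R.erase y := fun h => Finset.notMem_erase y R (h ▸ hy)
  rw [hpair, Finset.card_pair hneq]
  exact even_two

/-- **Scarf's lemma**, with slack elements `e i`: the element `e i` is the bottom of the `i`-th order
and lies above all non-slack elements in the other orders. Every colouring that gives the colour `i`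
to `e i` admits a dominant set that carries all colours. -/
theorem exists_dominant_colourful [Nontrivial I] {r : I → V → α}
    (hr : ∀ i, Function.Injective (r i)) (e : I → V) (hbot : ∀ i v, r i (e i) ≤ r i v)
    (htop : ∀ i j v, v ∉ Set.range e → j ≠ i → r i v < r i (e j)) (hne : ∃ v, v ∉ Set.range e)
    (c : V → I) (hc : ∀ i, c (e i) = i) :
    ∃ R : Finset V, Dominant r R ∧ R.card = Fintype.card I ∧ R.image c = Finset.univ := by
  by_contra hcon
  have hinje : Function.Injective e := Function.LeftInverse.injective hc
  obtain ⟨i₀⟩ : Nonempty I := inferInstance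
  -- `S₀` is the only door made of slack elements, and the only one that lies in a single room.
  set S₀ : Finset V := (Finset.univ.erase i₀).image e with hS₀
  have hcard₀ : S₀.card + 1 = Fintype.card I := by
    rw [hS₀, Finset.card_image_of_injective _ hinje, Finset.card_erase_add_one (Finset.mem_univ _),
      Finset.card_univ]
  have hdom₀ : Dominant r S₀ := by
    intro t
    by_cases ht : t ∈ Set.range e
    · obtain ⟨j, rfl⟩ := ht
      exact ⟨j, fun s _ => hbot j s⟩
    · refine ⟨i₀, fun s hs => ?_⟩
      obtain ⟨j, hj, rfl⟩ := Finset.mem_image.1 hs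
      exact (htop i₀ j t ht (Finset.mem_erase.1 hj).1).le
  have hS₀d : S₀ ∈ doors r c i₀ := by
    refine mem_doors.2 ⟨hdom₀, hcard₀, ?_⟩
    rw [hS₀, Finset.image_image]
    rw [show c ∘ e = id from funext hc, Finset.image_id]
  have hcount₀ : ((rooms r).filter (S₀ ⊆ ·)).card = 1 := by
    have hSne : S₀.Nonempty := by
      rw [← Finset.card_pos]
      have := Fintype.one_lt_card (α := I)
      omega
    obtain ⟨m, hm⟩ := exists_isMinChoice r hSne
    have hmj : ∀ j, j ≠ i₀ → m j = e j := fun j hj => hr j (le_antisymm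
      ((hm j).2 _ (Finset.mem_image_of_mem e (Finset.mem_erase.2 ⟨hj, Finset.mem_univ _⟩)))
      (hbot j _))
    obtain ⟨p, hp, hpe⟩ := Finset.mem_image.1 (hm i₀).1
    have hp₀ : p ≠ i₀ := (Finset.mem_erase.1 hp).1
    refine card_rooms_superset_eq_one hr hm hdom₀ hcard₀ hp₀.symm
      ((hmj p hp₀).trans hpe).symm ?_ ?_
    · obtain ⟨v, hv⟩ := hne
      refine ⟨v, fun k hk => ?_⟩
      rw [hmj k hk]
      exact lt_of_le_of_ne (hbot k v) fun h => hv ⟨k, hr k h⟩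
    -- A replacement would have to exceed `e p` in order `i₀`, which excludes non-slack elements, `e
    -- p` and `e i₀`; any other `e q` fails in its own order `q`.
    · rintro ⟨x, hx⟩
      have hx₀ := hx i₀ hp₀.symm
      by_cases hxr : x ∈ Set.range e
      · obtain ⟨q, rfl⟩ := hxr
        by_cases hq : q = i₀
        · subst hq
          exact absurd (hbot q (m q)) (not_le.2 hx₀)
        · by_cases hqp : q = p
          · subst hqp
            rw [hpe] at hx₀
            exact lt_irrefl _ hx₀
          · have := hx q hqp
            rw [hmj q hq] at this
            exact lt_irrefl _ this
      · rw [← hpe] at hx₀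
        exact lt_asymm hx₀ (htop i₀ p x hxr hp₀)
  have hcount : ∀ S ∈ (doors r c i₀).erase S₀, ((rooms r).filter (S ⊆ ·)).card = 2 := by
    intro S hS
    obtain ⟨hSne, hS⟩ := Finset.mem_erase.1 hS
    obtain ⟨hd, hcard, hi⟩ := mem_doors.1 hS
    -- Slack elements carry their own colours, so an all-slack door would be contained in `S₀`,
    -- hence equal to it.
    obtain ⟨v, hvS, hv⟩ : ∃ v ∈ S, v ∉ Set.range e := by
      by_contra hall
      push Not at hall
      refine hSne (Finset.eq_of_subset_of_card_le (fun s hs => ?_) (by omega))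
      obtain ⟨j, rfl⟩ := hall s hs
      refine Finset.mem_image_of_mem e ?_
      rw [← hi]
      exact Finset.mem_image.2 ⟨_, hs, hc j⟩
    obtain ⟨m, hm⟩ := exists_isMinChoice r ⟨v, hvS⟩
    obtain ⟨a, b, hab, h⟩ := hm.exists_pair hcard
    have hslack : ∀ j k, k ≠ j → m k ≠ e j := by
      intro j k hkj he
      have := (hm k).2 v hvS
      rw [he] at this
      exact absurd this (not_le.2 (htop k j v hv hkj.symm))
    -- Since `v` lies below every foreign slack element, each `m k` is non-slack or `e k`; in both
    -- cases `e j` exceeds it in order `k ≠ j`.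
    have hrep : ∀ j, Replaces r m j (e j) := by
      intro j k hkj
      by_cases hmk : m k ∈ Set.range e
      · obtain ⟨q, hq⟩ := hmk
        have hqk : q = k := by
          by_contra hne
          exact hslack q k (Ne.symm hne) hq.symm
        subst hqk
        rw [← hq]
        exact lt_of_le_of_ne (hbot q _) fun h => hkj (hinje (hr q h))
      · exact htop k j _ hmk hkj.symm
    exact card_rooms_superset_eq_two hr hm hd hcard hab h ⟨_, hrep a⟩ ⟨_, hrep b⟩
  -- Counted by doors, the incidences number one plus an even number; counted by rooms, none of
  -- which is colourful, they are even.
  have hsum := Finset.sum_card_bipartiteAbove_eq_sum_card_bipartiteBelow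
    (s := doors r c i₀) (t := rooms r) (fun S R => S ⊆ R)
  simp only [Finset.bipartiteAbove, Finset.bipartiteBelow] at hsum
  rw [← Finset.add_sum_erase _ _ hS₀d, hcount₀, Finset.sum_congr rfl hcount,
    Finset.sum_const, smul_eq_mul] at hsum
  have heven : Even (∑ R ∈ rooms r, ((doors r c i₀).filter (· ⊆ R)).card) :=
    Finset.even_sum _ fun R hR => even_card_doors_subset hR fun h =>
      hcon ⟨R, (mem_rooms.1 hR).1, (mem_rooms.1 hR).2, h⟩
  rw [← hsum] at heven
  obtain ⟨q, hq⟩ := heven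
  omega

end Count

end Scarf

/-! ### A covering theorem on the simplex -/

section Simplex

variable {ι : Type*} [Fintype ι]

/-- Scarf's lemma is applied to a finite net ordered by each coordinate. Dominance forces the net
points of the colourful room to be within `δ` of each other, and each colour comes from such a point
or from a slack element, which forces a small coordinate. -/
theorem exists_approx_common_point [Nontrivial ι] (G : ι → Set (ι → ℝ))
    (hcov : ∀ x ∈ stdSimplex ℝ ι, ∃ i, x ∈ G i) {δ : ℝ} (hδ : 0 < δ) :
    ∃ p ∈ stdSimplex ℝ ι, ∀ i, p i ≤ δ ∨ ∃ s ∈ G i, dist s p ≤ δ := by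
  classical
  have hn : (0 : ℝ) < Fintype.card ι := by exact_mod_cast Fintype.card_pos
  obtain ⟨T₀, hT₀, hfin, hnet⟩ := (isCompact_stdSimplex ℝ ι).finite_cover_balls
    (div_pos hδ hn)
  obtain ⟨T, rfl⟩ := hfin.exists_finset_coe
  have hTs : ∀ t : T, (t : ι → ℝ) ∈ stdSimplex ℝ ι := fun t => hT₀ t.2
  choose! col hcol using hcov
  -- Coordinates lie in `[0, 1]`, so `-1` and `2` put slack elements at the bottom and top; the
  -- enumerations break ties.
  let r : ι → T ⊕ ι → ℝ ×ₗ ℕ := fun i => Sum.elim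
    (fun t => toLex ((t : ι → ℝ) i, (Fintype.equivFin T t : ℕ)))
    (fun j => if j = i then toLex (-1, 0) else toLex (2, (Fintype.equivFin ι j : ℕ)))
  have hrl : ∀ i t, r i (Sum.inl t) = toLex ((t : ι → ℝ) i, (Fintype.equivFin T t : ℕ)) :=
    fun i t => rfl
  have hrr : ∀ i, r i (Sum.inr i) = toLex (-1, 0) := fun i => if_pos rfl
  have hrn : ∀ i j, j ≠ i → r i (Sum.inr j) = toLex (2, (Fintype.equivFin ι j : ℕ)) :=
    fun i j h => if_neg h
  have hcoord : ∀ (t : T) i, 0 ≤ (t : ι → ℝ) i ∧ (t : ι → ℝ) i ≤ 1 := fun t i =>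
    ⟨(hTs t).1 i, (hTs t).2 ▸ Finset.single_le_sum (fun j _ => (hTs t).1 j) (Finset.mem_univ i)⟩
  have hlow : ∀ i (t : T), r i (Sum.inr i) < r i (Sum.inl t) := by
    intro i t
    rw [hrr, hrl, Prod.Lex.toLex_lt_toLex]
    exact Or.inl (by have := (hcoord t i).1; dsimp only; linarith)
  have hhigh : ∀ i j (t : T), j ≠ i → r i (Sum.inl t) < r i (Sum.inr j) := by
    intro i j t hj
    rw [hrn i j hj, hrl, Prod.Lex.toLex_lt_toLex]
    exact Or.inl (by have := (hcoord t i).2; dsimp only; linarith)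
  have hlow' : ∀ i j, j ≠ i → r i (Sum.inr i) < r i (Sum.inr j) := by
    intro i j hj
    rw [hrr, hrn i j hj, Prod.Lex.toLex_lt_toLex]
    exact Or.inl (by norm_num)
  have hinj : ∀ i, Function.Injective (r i) := by
    rintro i (t | j) (t' | j') h
    · rw [hrl, hrl, toLex_inj, Prod.mk.injEq] at h
      rw [(Fintype.equivFin T).injective (Fin.ext h.2)]
    · by_cases hj : j' = i
      · exact absurd h (hj ▸ (hlow j' t).ne')
      · exact absurd h (hhigh i j' t hj).ne
    · by_cases hj : j = i
      · exact absurd h (hj ▸ (hlow j t').ne)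
      · exact absurd h (hhigh i j t' hj).ne'
    · by_cases hj : j = i <;> by_cases hj' : j' = i
      · rw [hj, hj']
      · exact absurd h (hj ▸ (hlow' j j' (hj ▸ hj')).ne)
      · exact absurd h (hj' ▸ (hlow' j' j (hj' ▸ hj)).ne')
      · rw [hrn i j hj, hrn i j' hj', toLex_inj, Prod.mk.injEq] at h
        rw [(Fintype.equivFin ι).injective (Fin.ext h.2)]
  obtain ⟨t₀, ht₀⟩ : T.Nonempty := by
    obtain ⟨i⟩ : Nonempty ι := inferInstance
    obtain ⟨t, ht, -⟩ := Set.mem_iUnion₂.1 (hnet (single_mem_stdSimplex ℝ i))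
    exact ⟨t, ht⟩
  obtain ⟨R, hdom, -, hRc⟩ := exists_dominant_colourful hinj (Sum.inr : ι → T ⊕ ι)
    (by
      rintro i (t | j)
      · exact (hlow i t).le
      · by_cases hj : j = i
        · rw [hj]
        · exact (hlow' i j hj).le)
    (by
      rintro i j (t | k) hv hj
      · exact hhigh i j t hj
      · exact absurd ⟨k, rfl⟩ hv)
    ⟨Sum.inl ⟨t₀, ht₀⟩, by rintro ⟨j, hj⟩; cases hj⟩
    (Sum.elim (fun t => col t) id) (fun i => rfl)
  have hcolour : ∀ i, Sum.inr i ∉ R → ∃ t : T, Sum.inl t ∈ R ∧ (t : ι → ℝ) ∈ G i := by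
    intro i hi
    obtain ⟨s, hs, hsi⟩ := Finset.mem_image.1 (hRc ▸ Finset.mem_univ i)
    rcases s with t | j
    · exact ⟨t, hs, hsi ▸ hcol t (hTs t)⟩
    · exact absurd ((show j = i from hsi) ▸ hs) hi
  have hbelow : ∀ t : T, ∃ i, Sum.inr i ∉ R ∧
      ∀ s : T, Sum.inl s ∈ R → (t : ι → ℝ) i ≤ (s : ι → ℝ) i := by
    intro t
    obtain ⟨i, hi⟩ := hdom (Sum.inl t)
    refine ⟨i, fun h => absurd (hi _ h) (not_le.2 (hlow i t)), fun s hs => ?_⟩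
    have := hi _ hs
    rw [hrl, hrl, Prod.Lex.toLex_le_toLex] at this
    rcases this with h | h
    · exact h.le
    · exact h.1.le
  let F : Finset T := Finset.univ.filter fun t => Sum.inl t ∈ R
  have hF : ∀ t, t ∈ F ↔ Sum.inl t ∈ R := fun t => by simp [F]
  have hFne : F.Nonempty := by
    obtain ⟨i, hi, -⟩ := hbelow ⟨t₀, ht₀⟩
    obtain ⟨t, ht, -⟩ := hcolour i hi
    exact ⟨t, (hF t).2 ht⟩
  let m : ι → ℝ := fun i => if Sum.inr i ∈ R then 0 else F.inf' hFne fun t => (t : ι → ℝ) i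
  have hmle : ∀ t ∈ F, ∀ i, m i ≤ (t : ι → ℝ) i := by
    intro t ht i
    by_cases hi : Sum.inr i ∈ R
    · simpa only [m, if_pos hi] using (hcoord t i).1
    · simpa only [m, if_neg hi] using Finset.inf'_le (fun t : T => (t : ι → ℝ) i) ht
  have hm0 : ∀ i, 0 ≤ m i := by
    intro i
    by_cases hi : Sum.inr i ∈ R
    · simp only [m, if_pos hi, le_refl]
    · simp only [m, if_neg hi]
      exact Finset.le_inf' _ _ fun t _ => (hcoord t i).1
  -- Otherwise, spreading the gap evenly over the coordinates of `m` gives a simplex point with a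
  -- nearby net point that exceeds `m` in every coordinate, against dominance.
  have hsum : 1 - ∑ i, m i ≤ δ := by
    by_contra hgap
    push Not at hgap
    have hps : (fun i => m i + (1 - ∑ i, m i) / Fintype.card ι) ∈ stdSimplex ℝ ι := by
      refine ⟨fun i => add_nonneg (hm0 i) (div_nonneg (hδ.trans hgap).le hn.le), ?_⟩
      rw [Finset.sum_add_distrib, Finset.sum_const, Finset.card_univ, nsmul_eq_mul,
        mul_div_cancel₀ _ hn.ne']
      ring
    obtain ⟨t, ht, hpt⟩ := Set.mem_iUnion₂.1 (hnet hps)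
    obtain ⟨i, hi, hle⟩ := hbelow ⟨t, ht⟩
    obtain ⟨s, hs, hms⟩ := F.exists_mem_eq_inf' hFne fun t => (t : ι → ℝ) i
    have h1 : t i ≤ m i := by
      simp only [m, if_neg hi, hms]
      exact hle s ((hF s).1 hs)
    have h2 := (dist_le_pi_dist _ t i).trans_lt (Metric.mem_ball.1 hpt)
    rw [Real.dist_eq] at h2
    have h3 := (abs_lt.1 h2).2
    have h4 : δ / Fintype.card ι < (1 - ∑ i, m i) / Fintype.card ι := by gcongr
    linarith
  have hup : ∀ t ∈ F, ∀ i, (t : ι → ℝ) i ≤ m i + δ := by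
    intro t ht i
    have h1 : (t : ι → ℝ) i - m i ≤ ∑ j, ((t : ι → ℝ) j - m j) :=
      Finset.single_le_sum (f := fun j => (t : ι → ℝ) j - m j)
        (fun j _ => sub_nonneg.2 (hmle t ht j)) (Finset.mem_univ i)
    rw [Finset.sum_sub_distrib, (hTs t).2] at h1
    linarith
  obtain ⟨p, hp⟩ := hFne
  refine ⟨p, hTs p, fun i => ?_⟩
  by_cases hi : Sum.inr i ∈ R
  · left
    have := hup p hp i
    simpa only [m, if_pos hi, zero_add] using this
  · right
    obtain ⟨s, hs, hsG⟩ := hcolour i hi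
    refine ⟨s, hsG, (dist_pi_le_iff hδ.le).2 fun k => ?_⟩
    have hsF := (hF s).2 hs
    rw [Real.dist_eq, abs_le]
    constructor <;> linarith [hmle s hsF k, hmle p hp k, hup s hsF k, hup p hp k]

/-- Closed sets that cover the simplex have a common point as soon as the `i`-th one contains the
face opposite to the `i`-th vertex. -/
theorem exists_common_point_of_face_subset [Nonempty ι] (G : ι → Set (ι → ℝ))
    (hcl : ∀ i, IsClosed (G i)) (hcov : ∀ x ∈ stdSimplex ℝ ι, ∃ i, x ∈ G i)
    (hface : ∀ x ∈ stdSimplex ℝ ι, ∀ i, x i = 0 → x ∈ G i) :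
    ∃ x ∈ stdSimplex ℝ ι, ∀ i, x ∈ G i := by
  classical
  rcases subsingleton_or_nontrivial ι with hι | hι
  · obtain ⟨i⟩ : Nonempty ι := inferInstance
    obtain ⟨j, hj⟩ := hcov _ (single_mem_stdSimplex ℝ i)
    exact ⟨_, single_mem_stdSimplex ℝ i, fun k => Subsingleton.elim j k ▸ hj⟩
  choose p hp hpG using fun k : ℕ =>
    exists_approx_common_point G hcov (δ := 1 / ((k : ℝ) + 1)) (by positivity)
  obtain ⟨x, hx, ψ, hψ, hlim⟩ := (isCompact_stdSimplex ℝ ι).tendsto_subseq hp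
  have hδ : Tendsto (fun k => 1 / ((ψ k : ℝ) + 1)) atTop (nhds 0) :=
    tendsto_one_div_add_atTop_nhds_zero_nat.comp hψ.tendsto_atTop
  refine ⟨x, hx, fun i => ?_⟩
  by_contra hxi
  -- With `x i` positive, the alternative of a vanishing coordinate fails for large `k`, so points
  -- of `G i` approach `x`.
  have hpos : 0 < x i := lt_of_le_of_ne (hx.1 i) fun h => hxi (hface x hx i h.symm)
  obtain ⟨ε, hε, hball⟩ := Metric.isOpen_iff.1 (hcl i).isOpen_compl x hxi
  have hcoord : Tendsto (fun k => p (ψ k) i) atTop (nhds (x i)) :=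
    (tendsto_pi_nhds.1 hlim) i
  have e1 := hcoord.eventually_const_lt (half_lt_self hpos)
  have e2 := hδ.eventually_lt_const (half_pos hpos)
  have e3 := (Metric.tendsto_nhds.1 hlim) (ε / 2) (half_pos hε)
  have e4 := hδ.eventually_lt_const (half_pos hε)
  obtain ⟨k, h1, h2, h3, h4⟩ := (e1.and (e2.and (e3.and e4))).exists
  rcases hpG (ψ k) i with h | ⟨s, hs, hd⟩
  · linarith
  · refine hball (Metric.mem_ball.2 ?_) hs
    have := dist_triangle s (p (ψ k)) x
    simp only [Function.comp_apply] at h3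
    linarith

end Simplex

/-! ### The Ky Fan inequality -/

section KyFan

variable {E : Type*} [AddCommGroup E] [Module ℝ E] [TopologicalSpace E] [ContinuousAdd E]
  [ContinuousSMul ℝ E]

/-- This is Nash's gain argument. The sets where `t i` times the total gain is at most the `i`-th
gain are closed, cover the simplex by summation, and contain the opposite faces. At a common point
with positive total gain, every `y i` of positive weight has `g > 0`, and concavity gives `g (c t)
(c t) > 0`. -/
theorem exists_le_zero_of_finite {ι : Type*} [Fintype ι] [Nonempty ι] {K : Set E}
    (hK : Convex ℝ K) (g : E → E → ℝ) (hcont : ∀ y ∈ K, ContinuousOn (fun x => g x y) K)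
    (hconc : ∀ x ∈ K, ConcaveOn ℝ K (g x)) (hdiag : ∀ x ∈ K, g x x ≤ 0) (y : ι → E)
    (hy : ∀ i, y i ∈ K) : ∃ x ∈ K, ∀ i, g x (y i) ≤ 0 := by
  let c : (ι → ℝ) → E := fun t => ∑ i, t i • y i
  have hc : Continuous c := by fun_prop
  have hcK : ∀ t ∈ stdSimplex ℝ ι, c t ∈ K := fun t ht =>
    hK.sum_mem (fun i _ => ht.1 i) ht.2 fun i _ => hy i
  have hgc : ∀ i, ContinuousOn (fun t => max 0 (g (c t) (y i))) (stdSimplex ℝ ι) := fun i =>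
    continuousOn_const.sup ((hcont _ (hy i)).comp hc.continuousOn hcK)
  have hcl : ∀ i, IsClosed {t ∈ stdSimplex ℝ ι |
      t i * ∑ j, max 0 (g (c t) (y j)) ≤ max 0 (g (c t) (y i))} := fun i =>
    IsClosed.isClosed_le (isClosed_stdSimplex ℝ ι)
      ((continuous_apply i).continuousOn.mul (continuousOn_finsetSum _ fun j _ => hgc j)) (hgc i)
  obtain ⟨t, ht, htG⟩ := exists_common_point_of_face_subset _ hcl
    (by
      intro t ht
      by_contra hcon
      push Not at hcon
      have hlt : ∀ i, max 0 (g (c t) (y i)) < t i * ∑ j, max 0 (g (c t) (y j)) := by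
        intro i
        by_contra h
        exact hcon i ⟨ht, not_lt.1 h⟩
      have := Finset.sum_lt_sum_of_nonempty Finset.univ_nonempty fun i (_ : i ∈ Finset.univ) => hlt i
      rw [← Finset.sum_mul, ht.2, one_mul] at this
      exact lt_irrefl _ this)
    (by
      intro t ht i hi
      refine ⟨ht, ?_⟩
      rw [hi, zero_mul]
      exact le_max_left _ _)
  refine ⟨c t, hcK t ht, ?_⟩
  by_contra hcon
  push Not at hcon
  obtain ⟨i₀, hi₀⟩ := hcon
  have hS : 0 < ∑ j, max 0 (g (c t) (y j)) :=
    (hi₀.trans_le (le_max_right _ _)).trans_le (Finset.single_le_sum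
      (f := fun j => max 0 (g (c t) (y j))) (fun j _ => le_max_left _ _) (Finset.mem_univ i₀))
  have hpos : ∀ i, 0 < t i → 0 < g (c t) (y i) := by
    intro i hi
    have := (mul_pos hi hS).trans_le (htG i).2
    exact (lt_max_iff.1 this).resolve_left (lt_irrefl _)
  have hle : ∑ i, t i • g (c t) (y i) ≤ g (c t) (c t) :=
    (hconc _ (hcK t ht)).le_map_sum (fun i _ => ht.1 i) ht.2 fun i _ => hy i
  have hnn : ∀ i ∈ Finset.univ, 0 ≤ t i • g (c t) (y i) := by
    intro i _
    rcases (ht.1 i).eq_or_lt with h | h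
    · rw [← h, zero_smul]
    · exact (smul_pos h (hpos i h)).le
  obtain ⟨i, hi⟩ : ∃ i, 0 < t i := by
    by_contra h
    push Not at h
    have := Finset.sum_nonpos fun i (_ : i ∈ Finset.univ) => h i
    rw [ht.2] at this
    exact absurd this (by norm_num)
  have h1 : 0 < ∑ i, t i • g (c t) (y i) :=
    Finset.sum_pos' hnn ⟨i, Finset.mem_univ i, smul_pos hi (hpos i hi)⟩
  exact absurd (hdiag _ (hcK t ht)) (not_le.2 (h1.trans_le hle))

/-- **Ky Fan inequality**. -/
theorem exists_forall_le_zero [T2Space E] {K : Set E} (hKc : IsCompact K) (hK : Convex ℝ K)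
    (hne : K.Nonempty) (g : E → E → ℝ) (hcont : ∀ y ∈ K, ContinuousOn (fun x => g x y) K)
    (hconc : ∀ x ∈ K, ConcaveOn ℝ K (g x)) (hdiag : ∀ x ∈ K, g x x ≤ 0) :
    ∃ x ∈ K, ∀ y ∈ K, g x y ≤ 0 := by
  have hcl : ∀ y : K, IsClosed {x ∈ K | g x y ≤ 0} := fun y =>
    IsClosed.isClosed_le hKc.isClosed (hcont y y.2) continuousOn_const
  have hfip : (K ∩ ⋂ y : K, {x ∈ K | g x y ≤ 0}).Nonempty := by
    refine hKc.inter_iInter_nonempty _ hcl fun s => ?_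
    obtain ⟨y₀, hy₀⟩ := hne
    -- The extra index carrying `y₀` keeps the family nonempty when `s` is empty.
    obtain ⟨x, hx, hxy⟩ := exists_le_zero_of_finite (ι := Option s) hK g hcont hconc hdiag
      (fun o => o.elim y₀ fun y => (y.1 : E))
      (by
        rintro (_ | y)
        · exact hy₀
        · exact y.1.2)
    exact ⟨x, hx, Set.mem_iInter₂.2 fun y hy => ⟨hx, hxy (some ⟨y, hy⟩)⟩⟩
  obtain ⟨x, hx, hxy⟩ := hfip
  exact ⟨x, hx, fun y hy => (Set.mem_iInter.1 hxy ⟨y, hy⟩).2⟩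

end KyFan

/-! ### Nash equilibria of concave games -/

section Nash

variable {l m : ℕ} {n : Fin l → ℕ}

theorem update_mem_of_forall_mem {X : (i : Fin l) → Set (EuclideanSpace ℝ (Fin (n i)))}
    {x : Profile n} (hx : ∀ i, x i ∈ X i) {i : Fin l} {y : EuclideanSpace ℝ (Fin (n i))}
    (hy : y ∈ X i) (j : Fin l) : Function.update x i y j ∈ X j := by
  by_cases h : j = i
  · subst h
    simpa using hy
  · simpa [h] using hx j

/-- A concave game has a Nash equilibrium if far away from some profile `xt` the total utility
increases when the players deviate to `xt`. -/
theorem exists_isNashEquilibrium (X : (i : Fin l) → Set (EuclideanSpace ℝ (Fin (n i))))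
    (F : Fin l → Profile n → ℝ) (hconv : ∀ i, Convex ℝ (X i)) (hclosed : ∀ i, IsClosed (X i))
    (hcont : ∀ i, ContinuousOn (F i) {x | ∀ i, x i ∈ X i})
    (hconc : ∀ i, ∀ x : Profile n, (∀ i, x i ∈ X i) →
      ConcaveOn ℝ (X i) fun y => F i (Function.update x i y))
    (xt : Profile n) (hxt : ∀ i, xt i ∈ X i) (R : ℝ)
    (hR : ∀ x : Profile n, (∀ i, x i ∈ X i) → R ≤ ‖x - xt‖ →
      ∑ i, F i x < ∑ i, F i (Function.update x i (xt i))) :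
    ∃ x : Profile n, IsNashEquilibrium X F x := by
  have hRpos : 0 < R := by
    by_contra h
    have := hR xt hxt (by simpa using h)
    simp at this
  have hpi : {x : Profile n | ∀ i, x i ∈ X i} = Set.univ.pi X := by
    ext x; simp
  have hPc : Convex ℝ {x : Profile n | ∀ i, x i ∈ X i} :=
    hpi ▸ convex_pi fun i _ => hconv i
  have hPcl : IsClosed {x : Profile n | ∀ i, x i ∈ X i} :=
    hpi ▸ isClosed_set_pi fun i _ => hclosed i
  set K : Set (Profile n) := {x | ∀ i, x i ∈ X i} ∩ Metric.closedBall xt R with hK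
  have hKconv : Convex ℝ K := hPc.inter (convex_closedBall xt R)
  have hKcomp : IsCompact K := (isCompact_closedBall xt R).inter_left hPcl
  have hxtK : xt ∈ K := ⟨hxt, Metric.mem_closedBall_self hRpos.le⟩
  let g : Profile n → Profile n → ℝ := fun x y =>
    ∑ i, F i (Function.update x i (y i)) - ∑ i, F i x
  have hgconc : ∀ x ∈ K, ConcaveOn ℝ {x : Profile n | ∀ i, x i ∈ X i} (g x) := by
    intro x hx
    refine ⟨hPc, fun y hy z hz a b ha hb hab => ?_⟩
    have : ∀ i, a * F i (Function.update x i (y i)) + b * F i (Function.update x i (z i)) ≤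
        F i (Function.update x i ((a • y + b • z) i)) := fun i =>
      (hconc i x hx.1).2 (hy i) (hz i) ha hb hab
    have hs := Finset.sum_le_sum fun i (_ : i ∈ Finset.univ) => this i
    rw [Finset.sum_add_distrib, ← Finset.mul_sum, ← Finset.mul_sum] at hs
    simp only [g, smul_eq_mul]
    have hc : a * ∑ i, F i x + b * ∑ i, F i x = ∑ i, F i x := by rw [← add_mul, hab, one_mul]
    linarith
  have hgdiag : ∀ x, g x x = 0 := fun x => by simp [g]
  obtain ⟨x, hxK, hx⟩ := exists_forall_le_zero hKcomp hKconv ⟨xt, hxtK⟩ g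
    (by
      intro y hy
      refine ContinuousOn.sub (continuousOn_finsetSum _ fun i _ => ?_)
        (continuousOn_finsetSum _ fun i _ => (hcont i).mono Set.inter_subset_left)
      refine (hcont i).comp (f := fun x => Function.update x i (y i)) 
        (continuous_id.update i continuous_const).continuousOn ?_
      exact fun x hx => update_mem_of_forall_mem hx.1 (hy.1 i))
    (fun x hx => (hgconc x hx).subset Set.inter_subset_left hKconv)
    (fun x _ => (hgdiag x).le)
  have hlt : ‖x - xt‖ < R := by
    by_contra h
    have h1 := hR x hxK.1 (not_lt.1 h)
    have h2 := hx xt hxtK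
    simp only [g] at h2
    linarith
  refine ⟨x, hxK.1, fun i y hy => ?_⟩
  -- `z` changes one block only, so `g x z` is the gain of player `i` alone. `z` may leave the ball,
  -- but a short step from `x` towards it does not, and concavity with `g x x = 0` carries the sign
  -- back to `z`.
  set z := Function.update x i y with hz
  have hzX : ∀ j, z j ∈ X j := update_mem_of_forall_mem hxK.1 hy
  have hgz : g x z = F i z - F i x := by
    simp only [g]
    rw [← Finset.sum_sub_distrib, Finset.sum_eq_single i]
    · simp [hz]
    · intro j _ hj
      simp [hz, hj]
    · simp
  have hev : ∀ᶠ s : ℝ in nhdsWithin 0 (Set.Ioi 0), ‖(1 - s) • x + s • z - xt‖ < R := by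
    have hc : Continuous fun s : ℝ => ‖(1 - s) • x + s • z - xt‖ := by fun_prop
    refine (hc.tendsto 0).eventually_lt_const (by simpa using hlt) |>.filter_mono nhdsWithin_le_nhds
  obtain ⟨s, hs, hs0, hs1⟩ := (hev.and (Ioo_mem_nhdsGT (zero_lt_one' ℝ))).exists
  have hw : (1 - s) • x + s • z ∈ K :=
    ⟨hPc hxK.1 hzX (sub_nonneg.2 hs1.le) hs0.le (by ring), by
      rw [Metric.mem_closedBall, dist_eq_norm]; exact hs.le⟩
  have h1 := (hgconc x hxK).2 hxK.1 hzX (sub_nonneg.2 hs1.le) hs0.le (by ring)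
  have h2 := h1.trans (hx _ hw)
  rw [hgdiag, smul_zero, zero_add, smul_eq_mul, hgz] at h2
  exact sub_nonpos.1 (nonpos_of_mul_nonpos_right h2 hs0)

theorem ConvexOn.continuous_of_univ {E : Type*} [NormedAddCommGroup E] [NormedSpace ℝ E]
    [FiniteDimensional ℝ E] {f : E → ℝ} (hf : ConvexOn ℝ Set.univ f) : Continuous f :=
  continuousOn_univ.1 (hf.continuousOn isOpen_univ)

/-! ### Continuity, concavity and coercivity of the penalized game -/

namespace JointGame

variable {G : JointGame l m n} {φ : (Fin m → ℝ) → ℝ}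

theorem _root_.IsPenalty.nonneg (hφ : IsPenalty φ) (v : Fin m → ℝ) : 0 ≤ φ v := by
  by_cases hv : v ≤ 0
  · exact (hφ.eq_zero v hv).ge
  · exact (hφ.pos v hv).le

theorem BasicAssumptions.continuous_penalty (hA : G.BasicAssumptions) (hφ : IsPenalty φ)
    (i : Fin l) (v : Fin m → ℝ) : Continuous fun y => φ (G.constr i y - v) :=
  hφ.differentiable.continuous.comp
    ((continuous_pi fun j => (hA.convex_constr i j).continuous_of_univ).sub continuous_const)

theorem BasicAssumptions.convexOn_penalty (hA : G.BasicAssumptions) (hφ : IsPenalty φ)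
    (i : Fin l) (v : Fin m → ℝ) : ConvexOn ℝ Set.univ fun y => φ (G.constr i y - v) := by
  refine ⟨convex_univ, fun y _ z _ a b ha hb hab => ?_⟩
  refine le_trans (hφ.isotone ?_)
    (hφ.convex.2 (Set.mem_univ (G.constr i y - v)) (Set.mem_univ (G.constr i z - v)) ha hb hab)
  intro j
  have h := (hA.convex_constr i j).2 (Set.mem_univ y) (Set.mem_univ z) ha hb hab
  simp only [Pi.sub_apply, Pi.add_apply, Pi.smul_apply, smul_eq_mul] at h ⊢
  have hv : a * v j + b * v j = v j := by rw [← add_mul, hab, one_mul]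
  linarith

theorem BasicAssumptions.continuousOn_penalizedUtility (hA : G.BasicAssumptions)
    (hφ : IsPenalty φ) (τ : ℝ) (u : Fin l → Fin m → ℝ) (i : Fin l) :
    ContinuousOn (G.penalizedUtility φ τ u i) G.profiles :=
  (hA.continuous_utility i).sub (continuous_const.mul
    ((hA.continuous_penalty hφ i (u i)).comp (continuous_apply i))).continuousOn

theorem BasicAssumptions.concaveOn_penalizedUtility (hA : G.BasicAssumptions)
    (hφ : IsPenalty φ) {τ : ℝ} (hτ : 0 ≤ τ) (u : Fin l → Fin m → ℝ) (i : Fin l) {x : Profile n}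
    (hx : x ∈ G.profiles) :
    ConcaveOn ℝ (G.strat i) fun y => G.penalizedUtility φ τ u i (Function.update x i y) := by
  have h := (hA.concave_utility i x hx).sub
    (((hA.convexOn_penalty hφ i (u i)).smul hτ).subset (Set.subset_univ _) (hA.convex_strat i))
  refine h.congr fun y _ => ?_
  simp [penalizedUtility]

theorem sum_penalizedUtility_update (φ : (Fin m → ℝ) → ℝ) (τ : ℝ) (u : Fin l → Fin m → ℝ)
    (x y : Profile n) : ∑ i, G.penalizedUtility φ τ u i (Function.update x i (y i)) =
      G.psi x y - τ * ∑ i, φ (G.constr i (y i) - u i) := by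
  simp [penalizedUtility, psi, Finset.mul_sum]

theorem sum_penalizedUtility (φ : (Fin m → ℝ) → ℝ) (τ : ℝ) (u : Fin l → Fin m → ℝ)
    (x : Profile n) : ∑ i, G.penalizedUtility φ τ u i x =
      G.psi x x - τ * ∑ i, φ (G.constr i (x i) - u i) := by
  simpa using sum_penalizedUtility_update (G := G) φ τ u x x

/-- Coercivity in terms of radii instead of sequences. -/
theorem Coercive.exists_radius (hC : G.Coercive) : ∃ xt ∈ G.profiles, ∀ c : ℝ, ∃ R : ℝ,
    ∀ x ∈ G.profiles, R ≤ ‖x - xt‖ → G.phi x xt < c := by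
  obtain ⟨xt, hxt, h⟩ := hC
  refine ⟨xt, hxt, fun c => ?_⟩
  by_contra hcon
  push Not at hcon
  choose x hx hnorm hge using fun k : ℕ => hcon k
  -- The norm of `Profile n` is the maximum of the block norms, hence at most the Euclidean one;
  -- escape at radius `k` in the former implies it in the latter.
  have hle : ∀ k, ‖x k - xt‖ ≤ ‖WithLp.toLp 2 (x k - xt)‖ := fun k =>
    (pi_norm_le_iff_of_nonneg (norm_nonneg _)).2 fun i =>
      PiLp.norm_apply_le (WithLp.toLp 2 (x k - xt)) i
  have hlim := h x hx (tendsto_atTop_mono (fun k => (hnorm k).trans (hle k))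
    tendsto_natCast_atTop_atTop)
  obtain ⟨k, hk⟩ := (hlim.eventually_lt_atBot c).exists
  exact absurd (hge k) (not_le.2 hk)

end JointGame

end Nash

theorem proposition3p2 {l m : ℕ} {n : Fin l → ℕ} (G : JointGame l m n)
    (hA : G.BasicAssumptions) (hC : G.Coercive)
    (φ : (Fin m → ℝ) → ℝ) (hφ : IsPenalty φ) :
    ∀ τ : ℝ, 0 < τ → ∀ u : Fin l → Fin m → ℝ,
      ∃ x : Profile n, IsNashEquilibrium G.strat (G.penalizedUtility φ τ u) x := by
  intro τ hτ u
  obtain ⟨xt, hxt, h⟩ := hC.exists_radius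
  -- The threshold is minus the total penalty at `xt`; the penalty at `x`, being nonnegative, only
  -- helps.
  obtain ⟨R, hR⟩ := h (-(τ * ∑ i, φ (G.constr i (xt i) - u i)))
  refine exists_isNashEquilibrium G.strat _ hA.convex_strat hA.closed_strat
    (hA.continuousOn_penalizedUtility hφ τ u)
    (fun i x hx => hA.concaveOn_penalizedUtility hφ hτ.le u i hx) xt hxt R fun x hx hxR => ?_
  rw [JointGame.sum_penalizedUtility, JointGame.sum_penalizedUtility_update]
  have h1 := hR x hx hxR
  rw [JointGame.phi] at h1
  have h2 : 0 ≤ τ * ∑ i, φ (G.constr i (x i) - u i) :=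
    mul_nonneg hτ.le (Finset.sum_nonneg fun i _ => hφ.nonneg _)
  linarith
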